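/- Let $G$ be a finite undirected graph, possibly with loops and multiple edges, with vertex set $V$ and edge set $E$, and let $b\colon V\to\mathbb{R}_{\ge 0}$. Let $$\mathcal{P}(G,b)=\Bigl\{x\in\mathbb{R}^E \Bigm| x_e\ge 0 \text{ for each } e\in E,\ \sum_{e\in\delta_G(v)}x_e=b_v\text{ for each } v\in V\Bigr\},$$ where $\delta_G(v)$ is the set of edges incident with $v$ (a loop at $v$ being counted once). For $x\in\mathcal{P}(G,b)$, let $\mathrm{gr}(x)$ be the spanning subgraph of $G$ with edge set $\{e\in E\mid x_e\neq 0\}$. A cycle of length $1$ is a vertex together with a loop attached to it, and a cycle of length $2$ is a pair of distinct vertices together with two distinct edges connecting them. Let $u$ and $w$ be distinct vertices of the polytope $\mathcal{P}(G,b)$. Then $u$ and $w$ are the vertices of an edge (a one-dimensional face) of $\mathcal{P}(G,b)$ if and only if the spanning subgraph $\mathrm{gr}(u)\cup\mathrm{gr}(w)$ of $G$ (whose edge set is the union of the two edge sets) has a connected component $C$ such that each component of $\mathrm{gr}(u)\cup\mathrm{gr}(w)$ other than $C$ either is acyclic or else contains exactly one cycle, with that cycle having odd length, while the cycle content of $C$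 is one of the following: - exactly one cycle, with that cycle having even length; or - exactly two cycles, with at least one of those cycles having odd length; or - exactly one even-length cycle and exactly two odd-length cycles, with any two of those three cycles sharing at least one edge. -/

import Mathlib

open scoped Graph NNReal

/-- `F` is an edge of the polytope `P`: a one-dimensional face. A face is the set of points of `P`
at which some linear functional attains its maximum over `P`; the dimension of a nonempty set is
the dimension of its affine hull. (The vertices of `P` are the points `x` for which `{x}` is a face,
that is, the elements of `P.exposedPoints ℝ`.) -/
def IsPolytopeEdge {W : Type*} [AddCommGroup W] [Module ℝ W] [TopologicalSpace W]
    (P F : Set W) : Prop :=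
  IsExposed ℝ P F ∧ F.Nonempty ∧ Module.finrank ℝ (vectorSpan ℝ F) = 1

/-- `u` and `w` are the vertices of an edge of the polytope `P`. -/
def AreVerticesOfEdge {W : Type*} [AddCommGroup W] [Module ℝ W] [TopologicalSpace W]
    (P : Set W) (u w : W) : Prop :=
  ∃ F : Set W, IsPolytopeEdge P F ∧ F.exposedPoints ℝ = {u, w}

namespace Graph

variable {α β : Type*}

open Classical in
/-- The fractional perfect `b`-matching polytope of `G`. The inner sum is over the edges incident
with `v`, where a loop at `v` is counted once. -/
def fracPerfectMatchingPolytope (G : Graph α β) [Fintype E(G)] (b : V(G) → ℝ≥0) :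
    Set (E(G) → ℝ) :=
  {x | (∀ e, 0 ≤ x e) ∧ ∀ v : V(G), ∑ e ∈ Finset.univ.filter (fun e : E(G) => G.Inc (e : β) v), x e = b v}

/-- The graph of a vector `x`: the spanning subgraph of `G` whose edges are those `e` with
`x e ≠ 0`. -/
def gr (G : Graph α β) (x : E(G) → ℝ) : Graph α β :=
  G.restrict {e | ∃ he : e ∈ E(G), x ⟨e, he⟩ ≠ 0}

/-- The union of two spanning subgraphs `H₁` and `H₂` of `G`. -/
def spanningUnion (G H₁ H₂ : Graph α β) : Graph α β :=
  G.restrict (E(H₁) ∪ E(H₂))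

/-- A graph is connected if it has a vertex and any two vertices are joined by a walk. -/
def IsConnected (G : Graph α β) : Prop :=
  V(G).Nonempty ∧ ∀ x ∈ V(G), ∀ y ∈ V(G), Relation.ReflTransGen G.Adj x y

/-- A component of `H` is a maximal connected subgraph of `H`. -/
def IsComponent (H C : Graph α β) : Prop :=
  Maximal (fun D : Graph α β => D ≤ H ∧ D.IsConnected) C

/-- `Z` is a cycle graph: for some `n ≥ 1` it consists of distinct vertices `v 0, …, v (n - 1)` and
distinct edges `e 0, …, e (n - 1)`, where `e i` joins `v i` to `v (i + 1)` (addition modulo `n`).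
For `n = 1` this is a vertex with a loop, for `n = 2` two vertices with two parallel edges. -/
def IsCycleGraph (Z : Graph α β) : Prop :=
  ∃ (n : ℕ) (_ : NeZero n) (v : Fin n → α) (e : Fin n → β),
    Function.Injective v ∧ Function.Injective e ∧
    V(Z) = Set.range v ∧ E(Z) = Set.range e ∧ ∀ i, Z.IsLink (e i) (v i) (v (i + 1))

/-- The set of cycles contained in `G`, as subgraphs of `G`. -/
def cycles (G : Graph α β) : Set (Graph α β) :=
  {Z | Z ≤ G ∧ Z.IsCycleGraph}

/-- The length of a cycle, that is, its number of edges. -/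
noncomputable def cycleLength (Z : Graph α β) : ℕ := E(Z).ncard

/-- `C` is acyclic, or contains exactly one cycle and that cycle has odd length. -/
def IsAcyclicOrOddUnicyclic (C : Graph α β) : Prop :=
  C.cycles = ∅ ∨ ∃ Z, C.cycles = {Z} ∧ Odd Z.cycleLength

/-- The cycle content of `C` is one of: exactly one cycle, of even length; exactly two cycles, at
least one of them of odd length; exactly one even-length and exactly two odd-length cycles, any two
of which share at least one edge. -/
def HasEdgeCycleContent (C : Graph α β) : Prop :=
  (∃ Z, C.cycles = {Z} ∧ Even Z.cycleLength) ∨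
  (∃ Z₁ Z₂, Z₁ ≠ Z₂ ∧ C.cycles = {Z₁, Z₂} ∧ (Odd Z₁.cycleLength ∨ Odd Z₂.cycleLength)) ∨
  (∃ Z₀ Z₁ Z₂, Z₁ ≠ Z₂ ∧ C.cycles = {Z₀, Z₁, Z₂} ∧
    Even Z₀.cycleLength ∧ Odd Z₁.cycleLength ∧ Odd Z₂.cycleLength ∧
    (E(Z₀) ∩ E(Z₁)).Nonempty ∧ (E(Z₀) ∩ E(Z₂)).Nonempty ∧ (E(Z₁) ∩ E(Z₂)).Nonempty)

end Graph

/-!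
Write `A` for the real vertex-edge incidence matrix of `G`, in which a loop is counted once, and `H`
for the union of the graphs of `u` and `w`. The polytope is `{x ≥ 0 | A x = b}`, and the smallest
face containing `u` and `w` consists of its points supported on `H`. Moving the midpoint of `u` and
`w` along kernel vectors of `A` supported on `H` stays in that face, so `u` and `w` span an edge if
and only if those kernel vectors form the line through `u - w` (`areVerticesOfEdge_iff`). Kernel
vectors split along the components of `H`, so this means that one component has nullity one and the
others have nullity zero (`Graph.forall_exists_eq_smul_iff`).

It remains to read off the nullity of a connected graph from its cycles. Over the field with two
elements, the kernel of the boundary matrix (loops counted twice, that is, not at all) is the cycle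
space. For a connected graph the left kernel of the boundary matrix is spanned by the all-ones
vector, and the real left kernel of `A` is spanned by the sign vector of a two-colouring if there is
one and is zero otherwise. Comparing ranks, the nullity equals the dimension `μ` of the cycle space
for a bipartite graph and `μ - 1` for a nonbipartite one. A graph with only even cycles is bipartite
(`Graph.exists_isTwoColoring_of_forall_even`), by duality and because every nonzero vector of the
cycle space has a cycle in its support.

Cycles correspond to distinct nonzero vectors of the cycle space, and `μ` is at most the size of any
set of edges meeting all cycles (`Graph.cyclomaticNumber_le_card`). Hence `μ = 0` means that there
are no cycles and `μ = 1` that there is exactly one. For `μ = 2` the cycle space has three nonzero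
vectors with sum zero, and these are either two cycles and their disjoint union, or the three cycles
of a theta graph, which pairwise share edges and have lengths with an even sum. The prescribed cycle
contents are therefore exactly the cases `μ = 1` bipartite and `μ = 2` nonbipartite.
-/

/-! ### Edges of a polyhedron in standard form -/

/-- A nonzero vector of a space spanned by one vector spans it. -/
theorem exists_eq_smul_of_finrank_eq_one {W : Type*} [AddCommGroup W] [Module ℝ W]
    {S : Submodule ℝ W} (hS : Module.finrank ℝ S = 1) {a d : W} (ha : a ∈ S) (ha0 : a ≠ 0)
    (hd : d ∈ S) : ∃ c : ℝ, d = c • a := by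
  obtain ⟨c, hc⟩ := (finrank_eq_one_iff_of_nonzero' (⟨a, ha⟩ : S) (by simpa using ha0)).1 hS ⟨d, hd⟩
  exact ⟨c, by simpa using (congrArg Subtype.val hc).symm⟩

/-- A line contains at most two exposed points of a set. -/
theorem eq_or_eq_of_mem_exposedPoints_of_collinear {W : Type*} [AddCommGroup W] [Module ℝ W]
    [TopologicalSpace W] {F : Set W} {u w z : W} (hu : u ∈ F.exposedPoints ℝ)
    (hw : w ∈ F.exposedPoints ℝ) (hz : z ∈ F.exposedPoints ℝ) (huw : u ≠ w) {t : ℝ}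
    (hzt : z = w + t • (u - w)) : z = u ∨ z = w := by
  obtain ⟨huF, lu, hlu⟩ := hu
  obtain ⟨hwF, lw, hlw⟩ := hw
  obtain ⟨hzF, lz, hlz⟩ := hz
  have e (l : StrongDual ℝ W) : l z = l w + t * (l u - l w) := by simp [hzt]
  have h1 := (hlu w hwF)
  have h2 := (hlw u huF)
  have h3 : lu w < lu u := lt_of_le_of_ne h1.1 fun h => huw (h1.2 h.ge).symm
  have h4 : lw u < lw w := lt_of_le_of_ne h2.1 fun h => huw (h2.2 h.ge)
  have h5 := (hlu z hzF).1
  have h6 := (hlw z hzF).1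
  rw [e] at h5 h6
  have t1 : t ≤ 1 := by
    by_contra! h
    nlinarith
  have t0 : 0 ≤ t := by
    by_contra! h
    nlinarith
  have h7 := hlz u huF
  have h8 := hlz w hwF
  rw [e] at h7 h8
  by_cases hlu : lz w ≤ lz u
  · exact .inl (h7.2 (by nlinarith)).symm
  · exact .inr (h8.2 (by nlinarith)).symm

/-- Two distinct vertices `u`, `w` of the polyhedron `{x ≥ 0 | f x = b}` span an edge if and only
if the kernel of `f`, restricted to vectors vanishing wherever both `u` and `w` do, is the line
through `u - w`. -/
theorem areVerticesOfEdge_iff {ι M : Type*} [Fintype ι] [AddCommGroup M] [Module ℝ M]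
    (f : (ι → ℝ) →ₗ[ℝ] M) (b : M) {P : Set (ι → ℝ)}
    (hP : ∀ x, x ∈ P ↔ (∀ i, 0 ≤ x i) ∧ f x = b) {u w : ι → ℝ}
    (hu : u ∈ P.exposedPoints ℝ) (hw : w ∈ P.exposedPoints ℝ) (huw : u ≠ w) :
    AreVerticesOfEdge P u w ↔
      ∀ d, f d = 0 → (∀ i, u i = 0 → w i = 0 → d i = 0) → ∃ c : ℝ, d = c • (u - w) := by
  have huP := (hP u).1 hu.1
  have hwP := (hP w).1 hw.1
  constructor
  · rintro ⟨F, ⟨hF, hne, hrank⟩, hvert⟩ d hd hsupp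
    have huF : u ∈ F := (hvert.symm ▸ Set.mem_insert u _ : u ∈ F.exposedPoints ℝ).1
    have hwF : w ∈ F := (hvert.symm ▸ Set.mem_insert_of_mem u rfl : w ∈ F.exposedPoints ℝ).1
    obtain ⟨l, hl⟩ := hF hne
    have huF' := huF
    have hwF' := hwF
    rw [hl] at huF' hwF'
    obtain ⟨-, hlu⟩ := huF'
    obtain ⟨-, hlw⟩ := hwF'
    have hluw : l u = l w := le_antisymm (hlw u hu.1) (hlu w hw.1)
    -- The midpoint of `u` and `w` can be moved a little in the directions `d` and `-d`.
    obtain ⟨ε, hε, hεd⟩ : ∃ ε > 0, ∀ i, ε * |d i| ≤ (u i + w i) / 2 := by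
      have hi (i) : ∃ ε > 0, ε * |d i| ≤ (u i + w i) / 2 := by
        by_cases h : u i + w i = 0
        · have := huP.1 i
          have := hwP.1 i
          refine ⟨1, one_pos, ?_⟩
          rw [hsupp i (by linarith) (by linarith)]
          simp [h]
        · have hpos : 0 < u i + w i := lt_of_le_of_ne (add_nonneg (huP.1 i) (hwP.1 i)) (Ne.symm h)
          refine ⟨(u i + w i) / 2 / (|d i| + 1), by positivity, ?_⟩
          rw [div_mul_eq_mul_div, div_le_iff₀ (by positivity)]
          nlinarith [abs_nonneg (d i)]
      choose ε hε hεd using hi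
      obtain ⟨δ, hδ, hδε⟩ := Pi.exists_forall_pos_add_lt (x := 0) hε
      simp only [Pi.zero_apply, zero_add] at hδε
      exact ⟨δ, hδ, fun i => (mul_le_mul_of_nonneg_right (hδε i).le (abs_nonneg _)).trans (hεd i)⟩
    set m : ι → ℝ := (2⁻¹ : ℝ) • (u + w) with hm
    have hlm : l m = l u := by simp [hm, ← hluw]; ring
    have hmem (s : ℝ) (hs : |s| = 1) : m + (s * ε) • d ∈ P := by
      refine (hP _).2 ⟨fun i => ?_, ?_⟩
      · have h1 := hεd i
        have h2 : |s * ε * d i| = ε * |d i| := by rw [abs_mul, abs_mul, hs, abs_of_pos hε, one_mul]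
        have h3 := neg_abs_le (s * ε * d i)
        simp [hm]
        linarith
      · simp only [hm, map_add, map_smul, huP.2, hwP.2, hd, smul_zero, add_zero]
        rw [← two_smul ℝ b, smul_smul]; norm_num
    have hp := hlu _ (hmem 1 (by simp))
    have hn := hlu _ (hmem (-1) (by simp))
    simp only [map_add, map_smul, hlm, smul_eq_mul] at hp hn
    have hld : l d = 0 := by nlinarith [mul_pos hε hε]
    have hmF : m ∈ F := by
      rw [hl]
      refine ⟨(hP _).2 ⟨fun i => ?_, ?_⟩, by rwa [hlm]⟩
      · have := huP.1 i
        have := hwP.1 i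
        simp [hm]; linarith
      · simp only [hm, map_add, map_smul, huP.2, hwP.2]
        rw [← two_smul ℝ b, smul_smul]; norm_num
    have hmdF : m + ε • d ∈ F := by
      rw [hl]
      refine ⟨by simpa using hmem 1 (by simp), ?_⟩
      simpa [hlm, hld] using hlu
    have h1 := vsub_mem_vectorSpan ℝ huF hwF
    have h2 := vsub_mem_vectorSpan ℝ hmdF hmF
    rw [vsub_eq_sub] at h1 h2
    obtain ⟨c, hc⟩ := exists_eq_smul_of_finrank_eq_one hrank h1 (sub_ne_zero.2 huw) h2
    refine ⟨ε⁻¹ * c, ?_⟩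
    rw [mul_smul, ← hc, add_sub_cancel_left, smul_smul, inv_mul_cancel₀ hε.ne', one_smul]
  · intro h
    classical
    set F : Set (ι → ℝ) := {x ∈ P | ∀ i, u i = 0 → w i = 0 → x i = 0} with hFdef
    have hFP : F ⊆ P := fun x hx => hx.1
    have huF : u ∈ F := ⟨hu.1, fun i h _ => h⟩
    have hwF : w ∈ F := ⟨hw.1, fun i _ h => h⟩
    have hline (x) (hx : x ∈ F) (y) (hy : y ∈ F) : ∃ c : ℝ, x - y = c • (u - w) := by
      refine h _ ?_ fun i h1 h2 => ?_
      · rw [map_sub, ((hP x).1 hx.1).2, ((hP y).1 hy.1).2, sub_self]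
      · simp [hx.2 i h1 h2, hy.2 i h1 h2]
    have hexp (z) (hz : z ∈ F) (hz' : z ∈ P.exposedPoints ℝ) : z ∈ F.exposedPoints ℝ := by
      obtain ⟨-, l, hl⟩ := hz'
      exact ⟨hz, l, fun y hy => hl y (hFP hy)⟩
    refine ⟨F, ⟨fun _ => ?_, ⟨u, huF⟩, ?_⟩, ?_⟩
    · -- `F` is cut out by minus the sum of the coordinates at which both `u` and `w` vanish.
      let l : StrongDual ℝ (ι → ℝ) :=
        -∑ i ∈ Finset.univ.filter (fun i => u i = 0 ∧ w i = 0), ContinuousLinearMap.proj i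
      have hl (x) : l x = -∑ i ∈ Finset.univ.filter (fun i => u i = 0 ∧ w i = 0), x i := by
        simp [l]
      refine ⟨l, Set.ext fun x => ⟨fun hx => ⟨hx.1, fun y hy => ?_⟩, fun hx => ⟨hx.1, ?_⟩⟩⟩
      · rw [hl, hl, neg_le_neg_iff]
        refine Finset.sum_le_sum fun i hi => ?_
        simp only [Finset.mem_filter, Finset.mem_univ, true_and] at hi
        rw [hx.2 i hi.1 hi.2]
        exact ((hP y).1 hy).1 i
      · intro i h1 h2
        have h0 := hx.2 u hu.1
        rw [hl, hl, neg_le_neg_iff, Finset.sum_eq_zero (f := u) (by simp +contextual)] at h0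
        have hnn : ∀ i ∈ Finset.univ.filter (fun i => u i = 0 ∧ w i = 0), 0 ≤ x i :=
          fun i _ => ((hP x).1 hx.1).1 i
        exact (Finset.sum_eq_zero_iff_of_nonneg hnn).1 (le_antisymm h0 (Finset.sum_nonneg hnn)) i
          (by simp [h1, h2])
    · have : vectorSpan ℝ F = Submodule.span ℝ {u - w} := by
        refine le_antisymm (Submodule.span_le.2 ?_) (Submodule.span_le.2 ?_)
        · rintro _ ⟨x, hx, y, hy, rfl⟩
          obtain ⟨c, hc⟩ := hline x hx y hy
          exact Submodule.mem_span_singleton.2 ⟨c, hc.symm⟩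
        · simpa using vsub_mem_vectorSpan ℝ huF hwF
      rw [this, finrank_span_singleton (sub_ne_zero.2 huw)]
    · refine Set.Subset.antisymm (fun z hz => ?_) ?_
      · obtain ⟨c, hc⟩ := hline z hz.1 w hwF
        simpa using eq_or_eq_of_mem_exposedPoints_of_collinear (hexp u huF hu)
          (hexp w hwF hw) hz huw (eq_add_of_sub_eq' hc)
      · rintro z (rfl | rfl)
        · exact hexp _ huF hu
        · exact hexp _ hwF hw

namespace Graph

variable {α β : Type*}

/-! ### Cycles -/

/-- A closed walk with distinct vertices and distinct edges traces out a cycle. -/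
theorem exists_cycle_of_fin {D : Graph α β} {n : ℕ} [NeZero n] {v : Fin n → α} {e : Fin n → β}
    (hv : v.Injective) (he : e.Injective) (h : ∀ i, D.IsLink (e i) (v i) (v (i + 1))) :
    ∃ Z ∈ D.cycles, E(Z) = Set.range e := by
  have hV : Set.range v ⊆ V(D) := by rintro _ ⟨i, rfl⟩; exact (h i).left_mem
  have hlink (i) : ((D.restrict (Set.range e)).induce (Set.range v)).IsLink (e i) (v i)
      (v (i + 1)) := ⟨⟨⟨i, rfl⟩, h i⟩, ⟨i, rfl⟩, ⟨i + 1, rfl⟩⟩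
  have hE : E((D.restrict (Set.range e)).induce (Set.range v)) = Set.range e := by
    refine Set.Subset.antisymm ?_ ?_
    · rintro f hf
      obtain ⟨x, y, hxy⟩ := exists_isLink_of_mem_edgeSet hf
      exact hxy.1.1
    · rintro _ ⟨i, rfl⟩
      exact (hlink i).edge_mem
  exact ⟨_, ⟨(induce_le (G := D.restrict (Set.range e)) hV).trans restrict_le,
    n, inferInstance, v, e, hv, he, rfl, hE, hlink⟩, hE⟩

/-- If every nonloop edge of a nonempty edge set `S` can be followed, at either end, by a different
edge of `S`, then `S` contains the edges of a cycle. -/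
theorem exists_cycle_of_forall_exists_ne {D : Graph α β} (hfin : V(D).Finite) {S : Set β}
    (hne : S.Nonempty) (hS : S ⊆ E(D))
    (h : ∀ e ∈ S, ∀ x y, D.IsLink e x y → x ≠ y → ∃ e' ∈ S, e' ≠ e ∧ D.Inc e' y) :
    ∃ Z ∈ D.cycles, E(Z) ⊆ S := by
  classical
  -- Directed edges in `S`, each with a successor that differs from it unless it is a loop.
  let T := {t : β × α × α // t.1 ∈ S ∧ D.IsLink t.1 t.2.1 t.2.2}
  have hnext (t : T) : ∃ t' : T, t'.1.2.1 = t.1.2.2 ∧ (t.1.2.1 ≠ t.1.2.2 → t'.1.1 ≠ t.1.1) := by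
    obtain ⟨⟨e, x, y⟩, he, hl⟩ := t
    by_cases hxy : x = y
    · subst hxy
      exact ⟨⟨⟨e, x, x⟩, he, hl⟩, rfl, fun h => absurd rfl h⟩
    · obtain ⟨e', he', hne', z, hz⟩ := h e he x y hl hxy
      exact ⟨⟨⟨e', y, z⟩, he', hz⟩, rfl, fun _ => hne'⟩
  choose next hnext1 hnext2 using hnext
  obtain ⟨e₀, he₀⟩ := hne
  obtain ⟨x₀, y₀, hl₀⟩ := exists_isLink_of_mem_edgeSet (hS he₀)
  let t (k : ℕ) : T := next^[k] ⟨⟨e₀, x₀, y₀⟩, he₀, hl₀⟩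
  let v (k : ℕ) : α := (t k).1.2.1
  let e (k : ℕ) : β := (t k).1.1
  have ht (k) : t (k + 1) = next (t k) := Function.iterate_succ_apply' _ _ _
  have hv (k) : v (k + 1) = (t k).1.2.2 := by simp only [v, ht, hnext1]
  have hlink (k) : D.IsLink (e k) (v k) (v (k + 1)) := by rw [hv]; exact (t k).2.2
  have heS (k) : e k ∈ S := (t k).2.1
  have hee (k) (hk : v k ≠ v (k + 1)) : e (k + 1) ≠ e k := by
    simp only [e, ht]
    exact hnext2 _ (by rwa [hv] at hk)
  -- `j` is the first time at which the walk revisits a vertex, namely `v i`.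
  have hrep : ∃ j, ∃ i < j, v i = v j := by
    have := hfin.to_subtype
    obtain ⟨a, b, hab, hvab⟩ := Finite.exists_ne_map_eq_of_infinite
      (fun k : ℕ => (⟨v k, (hlink k).left_mem⟩ : V(D)))
    have hvab' : v a = v b := congrArg Subtype.val hvab
    rcases lt_or_gt_of_ne hab with h | h
    · exact ⟨b, a, h, hvab'⟩
    · exact ⟨a, b, h, hvab'.symm⟩
  obtain ⟨i, hij, hvij⟩ := Nat.find_spec hrep
  set j := Nat.find hrep with hj
  have hinj {a b : ℕ} (hb : b < j) (hab : a < b) : v a ≠ v b := fun h =>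
    Nat.find_min hrep hb ⟨a, hab, h⟩
  have hinj' {a b : ℕ} (ha : a < j) (hb : b < j) (h : v a = v b) : a = b := by
    rcases lt_trichotomy a b with h' | h' | h'
    · exact absurd h (hinj hb h')
    · exact h'
    · exact absurd h.symm (hinj ha h')
  have heinj {a b : ℕ} (ha : i ≤ a) (hab : a < b) (hb : b < j) : e a ≠ e b := by
    intro hE
    have h1 := hlink a
    rw [hE] at h1
    rcases h1.eq_and_eq_or_eq_and_eq (hlink b) with ⟨h2, -⟩ | ⟨h2, h3⟩
    · exact hinj hb hab h2
    · have hb' : b = a + 1 := (hinj' (by omega) hb h3).symm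
      subst hb'
      refine hee a (fun h4 => ?_) hE.symm
      have := hinj' (by omega) hb h4
      omega
  obtain ⟨m, hm⟩ : ∃ m, j = i + (m + 1) := ⟨j - i - 1, by omega⟩
  obtain ⟨Z, hZ, hZE⟩ := exists_cycle_of_fin (D := D) (n := m + 1)
    (v := fun k => v (i + k)) (e := fun k => e (i + k))
    (fun a b hab => Fin.ext (by have := hinj' (by omega) (by omega) hab; omega))
    (fun a b hab => by
      rcases lt_trichotomy a b with h' | h' | h'
      · exact absurd hab (heinj (by omega) (by omega) (by omega))
      · exact h'
      · exact absurd hab.symm (heinj (by omega) (by omega) (by omega)))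
    (fun k => by
      have := hlink (i + k)
      rw [Fin.val_add_one]
      split_ifs with hk
      · have h1 : i + (k : ℕ) + 1 = j := by subst hk; simp; omega
        rw [h1, ← hvij] at this
        simpa using this
      · exact this)
  refine ⟨Z, hZ, ?_⟩
  rw [hZE]
  rintro _ ⟨k, rfl⟩
  exact heS _

theorem IsCycleGraph.vertexSet_eq {Z : Graph α β} (hZ : Z.IsCycleGraph) :
    V(Z) = {x | ∃ e ∈ E(Z), Z.Inc e x} := by
  obtain ⟨n, _, v, e, hv, he, hV, hE, hl⟩ := hZ
  refine Set.Subset.antisymm ?_ ?_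
  · rw [hV]
    rintro _ ⟨i, rfl⟩
    exact ⟨e i, (hl i).edge_mem, (hl i).inc_left⟩
  · rintro x ⟨e, -, hx⟩
    exact hx.vertex_mem

/-- A cycle of `D` is determined by its edge set, having no isolated vertices. -/
theorem cycles_eq_of_edgeSet_eq {D Z Z' : Graph α β} (hZ : Z ∈ D.cycles) (hZ' : Z' ∈ D.cycles)
    (h : E(Z) = E(Z')) : Z = Z' := by
  refine (Compatible.of_le_le hZ.1 hZ'.1).ext ?_ h
  rw [hZ.2.vertexSet_eq, hZ'.2.vertexSet_eq]
  ext x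
  simp only [Set.mem_ofPred_eq, ← h]
  refine exists_congr fun e => and_congr_right fun he => ?_
  rw [IsSubgraph.inc_congr hZ.1 he, IsSubgraph.inc_congr hZ'.1 (h ▸ he)]

theorem IsCycleGraph.edgeSet_nonempty {Z : Graph α β} (hZ : Z.IsCycleGraph) : E(Z).Nonempty := by
  obtain ⟨n, _, v, e, hv, he, hV, hE, hl⟩ := hZ
  exact ⟨e 0, (hl 0).edge_mem⟩

/-! ### The boundary operator over the field with two elements -/

open Classical in
/-- The vertex-edge incidence matrix of `D` modulo two, in which the column of a loop is zero. -/
noncomputable def boundary (D : Graph α β) : Matrix V(D) E(D) (ZMod 2) :=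
  fun v e => if D.IsNonloopAt e v then 1 else 0

open Classical in
/-- The indicator vector of the edge set of `Z`, as a vector indexed by the edges of `D`. -/
noncomputable def edgeIndicator (D Z : Graph α β) : E(D) → ZMod 2 :=
  fun e => if (e : β) ∈ E(Z) then 1 else 0

theorem edgeIndicator_ne_zero_iff {D Z : Graph α β} {e : E(D)} :
    D.edgeIndicator Z e ≠ 0 ↔ (e : β) ∈ E(Z) := by
  simp [edgeIndicator]

theorem boundary_col {D : Graph α β} [DecidableEq V(D)] {e : E(D)} {x y : V(D)}
    (h : D.IsLink e x y) :
    D.boundary.col e = Pi.single x 1 + Pi.single y 1 := by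
  ext z
  simp only [Matrix.col_apply, boundary, Pi.add_apply, Pi.single_apply]
  by_cases hxy : x = y
  · subst hxy
    have := (isLink_self_iff.1 h).not_isNonloopAt z
    rw [if_neg this]
    split_ifs <;> decide
  · have hne : (x : α) ≠ y := fun h' => hxy (Subtype.ext h')
    by_cases hzx : z = x
    · subst hzx
      rw [if_pos ⟨y, hne.symm, h⟩]
      simp [hxy]
    · by_cases hzy : z = y
      · subst hzy
        rw [if_pos ⟨x, hne, h.symm⟩]
        simp [hzx]
      · rw [if_neg]
        · simp [hzx, hzy]
        · intro h'
          rcases h'.inc.eq_or_eq_of_isLink h with h' | h'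
          · exact hzx (Subtype.ext h')
          · exact hzy (Subtype.ext h')

variable {D Z : Graph α β}

/-- The support of a nonzero vector of the cycle space meets every vertex an even number of times,
loops not counted, and so contains a cycle. -/
theorem exists_cycle_of_mulVec_boundary_eq_zero [Fintype E(D)] [Finite V(D)] {z : E(D) → ZMod 2}
    (hz : D.boundary.mulVec z = 0) (hz0 : z ≠ 0) :
    ∃ Z ∈ D.cycles, ∀ e : E(D), (e : β) ∈ E(Z) → z e ≠ 0 := by
  classical
  obtain ⟨e₀, he₀⟩ := Function.ne_iff.1 hz0
  obtain ⟨Z, hZ, hZS⟩ := exists_cycle_of_forall_exists_ne (D := D) (Set.toFinite _)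
    (S := {e | ∃ h : e ∈ E(D), z ⟨e, h⟩ ≠ 0}) ⟨e₀, e₀.2, he₀⟩ (fun e he => he.1) (by
      rintro e ⟨he, hze⟩ x y hl hxy
      by_contra! hcon
      have h1 := congrFun hz ⟨y, hl.right_mem⟩
      rw [Matrix.mulVec, dotProduct, Finset.sum_eq_single ⟨e, he⟩] at h1
      · have : D.IsNonloopAt e y := ⟨x, hxy, hl.symm⟩
        simp [boundary, this, hze] at h1
      · intro e' _ hne
        simp only [boundary]
        split_ifs with h2
        · by_contra h3
          exact hcon e' ⟨e'.2, fun h4 => h3 (by simp [h4])⟩ (fun h4 => hne (Subtype.ext h4)) h2.inc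
        · simp
      · simp)
  exact ⟨Z, hZ, fun e he => (hZS he).2⟩

/-- The boundary of a vector supported on the edges `e i` of a closed walk. -/
theorem mulVec_boundary_of_support [Fintype E(D)] [DecidableEq V(D)] {n : ℕ} [NeZero n]
    {v : Fin n → V(D)}
    {e : Fin n → E(D)} (he : e.Injective) (h : ∀ i, D.IsLink (e i) (v i) (v (i + 1)))
    {x : E(D) → ZMod 2} (hx : ∀ f ∉ Set.range e, x f = 0) :
    D.boundary.mulVec x = ∑ i, (x (e i) + x (e (i - 1))) • Pi.single (v i) 1 := by
  have h1 : D.boundary.mulVec x = ∑ i, x (e i) • D.boundary.col (e i) := by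
    rw [Matrix.mulVec_eq_sum]
    refine (Fintype.sum_of_injective e he _ _ (fun f hf => ?_) fun i => ?_).symm
    · simp [hx f hf]
    · ext; simp [mul_comm]
  rw [h1]
  simp_rw [boundary_col (h _), add_smul, smul_add, Finset.sum_add_distrib]
  congr 1
  convert! Equiv.sum_comp (Equiv.addRight (1 : Fin n))
    (fun i => x (e (i - 1)) • (Pi.single (v i) 1 : V(D) → ZMod 2)) using 3 with i
  simp

/-- The vertices and edges of a cycle, numbered cyclically, as vertices and edges of `D`. -/
theorem exists_fin_of_mem_cycles (hZ : Z ∈ D.cycles) :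
    ∃ (n : ℕ) (_ : NeZero n) (v : Fin n → V(D)) (e : Fin n → E(D)),
    v.Injective ∧ e.Injective ∧ (∀ f : E(D), (f : β) ∈ E(Z) ↔ f ∈ Set.range e) ∧
    Z.cycleLength = n ∧ ∀ i, D.IsLink (e i) (v i) (v (i + 1)) := by
  obtain ⟨hZD, n, hn, v, e, hv, he, hV, hE, hl⟩ := hZ
  refine ⟨n, hn, fun i => ⟨v i, ((hl i).mono hZD).left_mem⟩,
    fun i => ⟨e i, ((hl i).mono hZD).edge_mem⟩, fun a b hab => hv (by simpa using hab),
    fun a b hab => he (by simpa using hab), fun f => ?_, ?_, fun i => (hl i).mono hZD⟩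
  · rw [hE]
    simp [Subtype.ext_iff]
  · rw [cycleLength, hE, ← Set.image_univ, Set.ncard_image_of_injective _ he]
    simp

theorem mulVec_boundary_edgeIndicator [Fintype E(D)] (hZ : Z ∈ D.cycles) :
    D.boundary.mulVec (D.edgeIndicator Z) = 0 := by
  classical
  obtain ⟨n, hn, v, e, hv, he, hE, -, hl⟩ := exists_fin_of_mem_cycles hZ
  rw [mulVec_boundary_of_support he hl (x := D.edgeIndicator Z)]
  · have h1 (i) : D.edgeIndicator Z (e i) = 1 := by simp [edgeIndicator, hE]
    simp [h1, show (1 : ZMod 2) + 1 = 0 from rfl]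
  · intro f hf
    simp [edgeIndicator, hE, hf]

theorem edgeIndicator_ne_zero (hZ : Z ∈ D.cycles) : D.edgeIndicator Z ≠ 0 := by
  obtain ⟨e, he⟩ := IsCycleGraph.edgeSet_nonempty hZ.2
  exact Function.ne_iff.2 ⟨⟨e, (hZ.1.edgeSet_mono he)⟩, edgeIndicator_ne_zero_iff.2 he⟩

theorem edgeIndicator_injOn : Set.InjOn D.edgeIndicator D.cycles := by
  intro Z hZ Z' hZ' h
  refine cycles_eq_of_edgeSet_eq hZ hZ' (Set.ext fun e => ?_)
  have h1 (he : e ∈ E(D)) := congrFun h ⟨e, he⟩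
  constructor
  · intro he
    rw [← edgeIndicator_ne_zero_iff (e := ⟨e, hZ.1.edgeSet_mono he⟩), ← h1]
    exact edgeIndicator_ne_zero_iff.2 he
  · intro he
    rw [← edgeIndicator_ne_zero_iff (e := ⟨e, hZ'.1.edgeSet_mono he⟩), h1]
    exact edgeIndicator_ne_zero_iff.2 he

/-- A vector of the cycle space supported on a single cycle is zero or the indicator of it. -/
theorem eq_zero_or_eq_edgeIndicator [Fintype E(D)] (hZ : Z ∈ D.cycles) {x : E(D) → ZMod 2}
    (hx : D.boundary.mulVec x = 0) (hxZ : ∀ e : E(D), (e : β) ∉ E(Z) → x e = 0) :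
    x = 0 ∨ x = D.edgeIndicator Z := by
  classical
  obtain ⟨n, hn, v, e, hv, he, hE, -, hl⟩ := exists_fin_of_mem_cycles hZ
  have hxe (f) (hf : f ∉ Set.range e) : x f = 0 := hxZ f (by rwa [hE])
  rw [mulVec_boundary_of_support he hl hxe] at hx
  have hstep (i : Fin n) : x (e i) = x (e (i - 1)) := by
    have := congrFun hx (v i)
    rw [Finset.sum_apply, Finset.sum_eq_single i] at this
    · simpa [CharTwo.add_eq_zero] using this
    · intro j _ hj
      have hne : v i ≠ v j := fun h => hj (hv h).symm
      simp [hne]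
    · simp
  have hconst (i : Fin n) : x (e i) = x (e 0) := by
    obtain ⟨k, hk⟩ := i
    induction k with
    | zero => rfl
    | succ k ih =>
      rw [← ih (by omega), hstep]
      congr 2
      have : NeZero n := hn
      obtain ⟨m, rfl⟩ : ∃ m, n = m + 1 := ⟨n - 1, by omega⟩
      rw [sub_eq_iff_eq_add]
      ext
      rw [Fin.val_add_one_of_lt]
      rw [Fin.lt_def]; simp; omega
  have h01 : ∀ a : ZMod 2, a = 0 ∨ a = 1 := by decide
  rcases h01 (x (e 0)) with h0 | h0
  · left
    ext f
    by_cases hf : f ∈ Set.range e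
    · obtain ⟨i, rfl⟩ := hf
      simp [hconst, h0]
    · exact hxe f hf
  · right
    ext f
    by_cases hf : f ∈ Set.range e
    · obtain ⟨i, rfl⟩ := hf
      simp [hconst, h0, edgeIndicator, hE]
    · simp [edgeIndicator, hE, hf, hxe f hf]

theorem sum_edgeIndicator [Fintype E(D)] (hZ : Z ∈ D.cycles) :
    ∑ e, D.edgeIndicator Z e = Z.cycleLength := by
  obtain ⟨n, hn, v, e, hv, he, hE, hlen, hl⟩ := exists_fin_of_mem_cycles hZ
  rw [← Fintype.sum_of_injective e he (fun _ => 1) _ ?_ ?_, hlen]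
  · simp
  · intro f hf
    simp [edgeIndicator, hE, hf]
  · intro i
    simp [edgeIndicator, hE]

end Graph

/-! ### Rank and nullity -/

/-- The kernels of a matrix and of its transpose differ in dimension by the difference of the
numbers of columns and rows. -/
theorem Matrix.finrank_ker_mulVecLin_add_card {K m n : Type*} [Field K] [Fintype m] [Fintype n]
    (A : Matrix m n K) :
    Module.finrank K A.mulVecLin.ker + Fintype.card m =
      Fintype.card n + Module.finrank K A.transpose.mulVecLin.ker := by
  have h1 := A.mulVecLin.finrank_range_add_finrank_ker
  have h2 := A.transpose.mulVecLin.finrank_range_add_finrank_ker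
  have h3 := A.rank_transpose
  simp only [Matrix.rank, Module.finrank_pi] at h1 h2 h3
  omega

/-- A plane over the field with two elements has only three nonzero vectors, and their sum is
zero. -/
theorem add_eq_of_finrank_eq_two {W : Type*} [AddCommGroup W] [Module (ZMod 2) W]
    (h : Module.finrank (ZMod 2) W = 2) {x y z : W} (hx : x ≠ 0) (hy : y ≠ 0) (hz : z ≠ 0)
    (hxy : x ≠ y) (hxz : x ≠ z) (hyz : y ≠ z) : x + y = z := by
  classical
  have : Module.Finite (ZMod 2) W := Module.finite_of_finrank_pos (by omega)
  have : Finite W := Module.finite_of_finite (ZMod 2)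
  have := Fintype.ofFinite W
  have hcard : Fintype.card W = 4 := by
    rw [← Nat.card_eq_fintype_card, Module.natCard_eq_pow_finrank (K := ZMod 2), h]; simp
  by_contra hne
  have hxy0 : x + y ≠ 0 := fun h' => hxy <| add_right_cancel <| h'.trans <| by
    rw [← two_smul (ZMod 2) y, show (2 : ZMod 2) = 0 from rfl, zero_smul]
  have h5 : ({0, x, y, z, x + y} : Finset W).card = 5 := by
    repeat rw [Finset.card_insert_of_notMem]
    · simp
    all_goals simp [hxy, hxz, hyz, hx, hy, hx.symm, hy.symm, hz.symm, hxy0.symm, Ne.symm hne]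
  have h6 := Finset.card_le_univ ({0, x, y, z, x + y} : Finset W)
  omega

namespace Graph

variable {α β : Type*} {D : Graph α β}

/-! ### The real incidence matrix -/

open Classical in
/-- The real vertex-edge incidence matrix of `D`, in which a loop has a single entry `1`. -/
noncomputable def incidence (D : Graph α β) : Matrix V(D) E(D) ℝ :=
  fun v e => if D.Inc e v then 1 else 0

/-- The dimension of the kernel of the real incidence matrix. -/
noncomputable def nullity (D : Graph α β) [Fintype E(D)] : ℕ :=
  Module.finrank ℝ D.incidence.mulVecLin.ker

/-- The dimension of the cycle space over the field with two elements. -/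
noncomputable def cyclomaticNumber (D : Graph α β) [Fintype E(D)] : ℕ :=
  Module.finrank (ZMod 2) D.boundary.mulVecLin.ker

/-- A proper two-colouring of the vertices, with colours in `ZMod 2`. -/
def IsTwoColoring (D : Graph α β) (s : V(D) → ZMod 2) : Prop :=
  ∀ (e : E(D)) (x y : V(D)), D.IsLink e x y → s x + s y = 1

theorem mulVec_transpose_boundary [Fintype V(D)] {e : E(D)} {x y : V(D)} (h : D.IsLink e x y)
    (p : V(D) → ZMod 2) : D.boundary.transpose.mulVec p e = p x + p y := by
  classical
  have : D.boundary.transpose.mulVec p e = D.boundary.col e ⬝ᵥ p := rfl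
  rw [this, boundary_col h, add_dotProduct, single_one_dotProduct, single_one_dotProduct]

/-- The vectors orthogonal to the column of an edge `e = xy` are those with `p x + p y = 0`; for a
loop this says that `p x = 0`. -/
theorem mulVec_transpose_incidence_eq_zero_iff [Fintype V(D)] {e : E(D)} {x y : V(D)}
    (h : D.IsLink e x y) (p : V(D) → ℝ) :
    D.incidence.transpose.mulVec p e = 0 ↔ p x + p y = 0 := by
  classical
  have h1 : D.incidence.transpose.mulVec p e = ∑ v, if v = x ∨ v = y then p v else 0 := by
    simp only [Matrix.mulVec, dotProduct, Matrix.transpose_apply, incidence, ite_mul, one_mul,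
      zero_mul]
    refine Finset.sum_congr rfl fun v _ => ?_
    congr 1
    rw [eq_iff_iff]
    constructor
    · intro hv
      simpa [Subtype.ext_iff] using hv.eq_or_eq_of_isLink h
    · rintro (rfl | rfl)
      · exact h.inc_left
      · exact h.inc_right
  rw [h1]
  by_cases hxy : x = y
  · subst hxy
    simp
  · rw [← Finset.sum_filter, show Finset.univ.filter (fun v => v = x ∨ v = y) = {x, y} by ext; simp,
      Finset.sum_pair hxy]

/-- A property of vertices that is preserved by adjacency spreads over a connected graph. -/
theorem IsConnected.forall_of_forall_isLink (hD : D.IsConnected) {p : V(D) → Prop}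
    (h : ∀ (e : E(D)) (x y : V(D)), D.IsLink e x y → p x → p y) {x₀ : V(D)} (h0 : p x₀)
    (x : V(D)) : p x := by
  have key (y : α) (hy : Relation.ReflTransGen D.Adj x₀ y) : ∀ hy' : y ∈ V(D), p ⟨y, hy'⟩ := by
    induction hy with
    | refl => exact fun _ => h0
    | tail _ hbc ih =>
      obtain ⟨e, he⟩ := hbc
      exact fun hc => h ⟨e, he.edge_mem⟩ ⟨_, he.left_mem⟩ ⟨_, hc⟩ he (ih he.left_mem)
  exact key x (hD.2 _ x₀.2 _ x.2) x.2

theorem exists_isLink (e : E(D)) : ∃ x y : V(D), D.IsLink e x y := by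
  obtain ⟨x, y, h⟩ := exists_isLink_of_mem_edgeSet e.2
  exact ⟨⟨x, h.left_mem⟩, ⟨y, h.right_mem⟩, h⟩

/-- Euler's formula for the cyclomatic number of a connected graph. -/
theorem IsConnected.cyclomaticNumber_add_card (hD : D.IsConnected) [Fintype V(D)]
    [Fintype E(D)] : D.cyclomaticNumber + Fintype.card V(D) = Fintype.card E(D) + 1 := by
  rw [cyclomaticNumber, Matrix.finrank_ker_mulVecLin_add_card]
  congr 1
  obtain ⟨x₀, hx₀⟩ := hD.1
  have hone : D.boundary.transpose.mulVec 1 = 0 := by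
    ext e
    obtain ⟨x, y, h⟩ := exists_isLink e
    rw [mulVec_transpose_boundary h]
    rfl
  refine (finrank_eq_one_iff_of_nonzero'
    (⟨1, hone⟩ : LinearMap.ker D.boundary.transpose.mulVecLin) ?_).2 ?_
  · intro h
    have := congrFun (congrArg Subtype.val h) ⟨x₀, hx₀⟩
    simp at this
  · rintro ⟨p, hp⟩
    refine ⟨p ⟨x₀, hx₀⟩, Subtype.ext (funext fun x => ?_)⟩
    suffices h : p x = p ⟨x₀, hx₀⟩ by simp [h]
    refine hD.forall_of_forall_isLink (p := fun x => p x = p ⟨x₀, hx₀⟩) ?_ rfl x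
    intro e x y h hx
    have h1 := congrFun hp e
    rw [Matrix.mulVecLin_apply, mulVec_transpose_boundary h, Pi.zero_apply,
      CharTwo.add_eq_zero] at h1
    rw [← h1, hx]

theorem IsTwoColoring.even_cycleLength {s : V(D) → ZMod 2} (hs : D.IsTwoColoring s)
    {Z : Graph α β} (hZ : Z ∈ D.cycles) : Even Z.cycleLength := by
  obtain ⟨n, hn, v, e, hv, he, hE, hlen, hl⟩ := exists_fin_of_mem_cycles hZ
  rw [hlen, ← ZMod.natCast_eq_zero_iff_even]
  -- Each colour is counted twice in the sum of the end colours over the edges of the cycle.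
  calc (n : ZMod 2) = ∑ i, (s (v i) + s (v (i + 1))) := by
        rw [Finset.sum_congr rfl fun i _ => hs _ _ _ (hl i)]; simp
    _ = ∑ i, s (v i) + ∑ i, s (v i) := by
        rw [Finset.sum_add_distrib]
        congr 1
        exact Equiv.sum_comp (Equiv.addRight (1 : Fin n)) fun i => s (v i)
    _ = 0 := CharTwo.add_self_eq_zero _

theorem sum_eq_zero_of_forall_even [Finite V(D)] [Fintype E(D)]
    (hD : ∀ Z ∈ D.cycles, Even Z.cycleLength) {z : E(D) → ZMod 2}
    (hz : D.boundary.mulVec z = 0) : ∑ e, z e = 0 := by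
  classical
  -- Remove cycles from the support of `z` one at a time.
  induction hn : (Finset.univ.filter fun e => z e ≠ 0).card using Nat.strong_induction_on
    generalizing z with
  | _ n ih =>
    by_cases hz0 : z = 0
    · simp [hz0]
    obtain ⟨Z, hZ, hZz⟩ := exists_cycle_of_mulVec_boundary_eq_zero hz hz0
    have h1 : ∑ e, (z + D.edgeIndicator Z) e = 0 := by
      refine ih _ ?_ (by rw [Matrix.mulVec_add, hz, mulVec_boundary_edgeIndicator hZ, add_zero]) rfl
      rw [← hn]
      refine Finset.card_lt_card ((Finset.ssubset_iff_of_subset fun e he => ?_).2 ?_)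
      · by_contra h
        simp only [Finset.mem_filter, Finset.mem_univ, true_and, not_not, Pi.add_apply] at he h
        rw [h, zero_add] at he
        exact hZz e (edgeIndicator_ne_zero_iff.1 he) h
      · obtain ⟨e, he⟩ := IsCycleGraph.edgeSet_nonempty hZ.2
        refine ⟨⟨e, hZ.1.edgeSet_mono he⟩, by simpa using hZz ⟨e, hZ.1.edgeSet_mono he⟩ he, ?_⟩
        have h2 : ∀ a b : ZMod 2, a ≠ 0 → b ≠ 0 → a + b = 0 := by decide
        simpa using h2 _ _ (hZz ⟨e, hZ.1.edgeSet_mono he⟩ he) (edgeIndicator_ne_zero_iff.2 he)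
    simpa [Finset.sum_add_distrib, sum_edgeIndicator hZ,
      (ZMod.natCast_eq_zero_iff_even).2 (hD Z hZ)] using h1

/-- A graph all of whose cycles are even is bipartite: by duality, the all-ones vector on the edges
is a combination of rows of the boundary matrix as soon as it is orthogonal to the cycle space. -/
theorem exists_isTwoColoring_of_forall_even [Finite V(D)] [Fintype E(D)]
    (hD : ∀ Z ∈ D.cycles, Even Z.cycleLength) : ∃ s, D.IsTwoColoring s := by
  classical
  let φ : Module.Dual (ZMod 2) (E(D) → ZMod 2) := ∑ e, LinearMap.proj e
  have hφ : φ ∈ D.boundary.mulVecLin.dualMap.range := by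
    rw [LinearMap.range_dualMap_eq_dualAnnihilator_ker, Submodule.mem_dualAnnihilator]
    intro z hz
    simpa [φ] using sum_eq_zero_of_forall_even hD hz
  obtain ⟨g, hg⟩ := hφ
  refine ⟨fun v => g (Pi.single v 1), fun e x y h => ?_⟩
  have h1 := LinearMap.congr_fun hg (Pi.single e 1)
  rw [LinearMap.dualMap_apply, Matrix.mulVecLin_apply, Matrix.mulVec_single_one, boundary_col h,
    map_add] at h1
  rw [h1]
  simp [φ]

/-- The left kernel of the incidence matrix of a connected bipartite graph is one-dimensional, just
like that of the boundary matrix. -/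
theorem IsConnected.nullity_eq_of_isTwoColoring (hD : D.IsConnected) [Finite V(D)]
    [Fintype E(D)] {s : V(D) → ZMod 2} (hs : D.IsTwoColoring s) :
    D.nullity = D.cyclomaticNumber := by
  have := Fintype.ofFinite V(D)
  have h1 := hD.cyclomaticNumber_add_card
  have h2 := D.incidence.finrank_ker_mulVecLin_add_card
  suffices h : Module.finrank ℝ D.incidence.transpose.mulVecLin.ker = 1 by
    rw [nullity]; omega
  obtain ⟨x₀, hx₀⟩ := hD.1
  -- The sign vector of the colouring spans the left kernel.
  let q : V(D) → ℝ := fun v => if s v = 0 then 1 else -1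
  have hq0 (v) : q v ≠ 0 := by simp only [q]; split_ifs <;> norm_num
  have hqq (e : E(D)) (x y : V(D)) (h : D.IsLink e x y) : q x + q y = 0 := by
    have h3 := hs e x y h
    have h4 : ∀ a b : ZMod 2, a + b = 1 → (a = 0 ↔ ¬ b = 0) := by decide
    have h5 := h4 _ _ h3
    by_cases h6 : s y = 0 <;> simp [q, h5, h6]
  have hq : D.incidence.transpose.mulVec q = 0 := by
    ext e
    obtain ⟨x, y, h⟩ := exists_isLink e
    exact (mulVec_transpose_incidence_eq_zero_iff h q).2 (hqq e x y h)
  refine (finrank_eq_one_iff_of_nonzero'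
    (⟨q, hq⟩ : LinearMap.ker D.incidence.transpose.mulVecLin) ?_).2 ?_
  · intro h
    exact hq0 ⟨x₀, hx₀⟩ (congrFun (congrArg Subtype.val h) ⟨x₀, hx₀⟩)
  · rintro ⟨p, hp⟩
    refine ⟨p ⟨x₀, hx₀⟩ / q ⟨x₀, hx₀⟩, Subtype.ext (funext fun x => ?_)⟩
    refine hD.forall_of_forall_isLink
      (p := fun x => p ⟨x₀, hx₀⟩ / q ⟨x₀, hx₀⟩ * q x = p x) ?_
      (div_mul_cancel₀ _ (hq0 _)) x
    intro e x y h hx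
    have h3 := (mulVec_transpose_incidence_eq_zero_iff h p).1 (congrFun hp e)
    have h4 := hqq e x y h
    rw [eq_neg_of_add_eq_zero_right h3, eq_neg_of_add_eq_zero_right h4, mul_neg, hx]

/-- An odd cycle makes the left kernel of the incidence matrix trivial, which costs one dimension
compared with the boundary matrix. -/
theorem IsConnected.nullity_add_one_of_odd (hD : D.IsConnected) [Finite V(D)]
    [Fintype E(D)] {Z : Graph α β} (hZ : Z ∈ D.cycles) (hodd : Odd Z.cycleLength) :
    D.nullity + 1 = D.cyclomaticNumber := by
  have := Fintype.ofFinite V(D)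
  have h1 := hD.cyclomaticNumber_add_card
  have h2 := D.incidence.finrank_ker_mulVecLin_add_card
  suffices h : Module.finrank ℝ D.incidence.transpose.mulVecLin.ker = 0 by
    rw [nullity]; omega
  rw [Submodule.finrank_eq_zero, LinearMap.ker_eq_bot']
  intro p hp
  have hpp (e : E(D)) (x y : V(D)) (h : D.IsLink e x y) : p x + p y = 0 :=
    (mulVec_transpose_incidence_eq_zero_iff h p).1 (congrFun hp e)
  -- The signs of a nonzero vector in the left kernel would be a proper two-colouring.
  by_contra hne
  obtain ⟨x₀, hx₀⟩ := Function.ne_iff.1 hne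
  have hp0 (x) : p x ≠ 0 := by
    refine hD.forall_of_forall_isLink (p := fun x => p x ≠ 0) ?_ hx₀ x
    intro e x y h hx hy
    have := hpp e x y h
    rw [hy, add_zero] at this
    exact hx this
  have hs : D.IsTwoColoring fun v => if 0 < p v then 1 else 0 := by
    intro e x y h
    have h3 := hpp e x y h
    rcases lt_or_gt_of_ne (hp0 y) with h4 | h4
    · simp [show 0 < p x by linarith, h4.le]
    · simp [show p x ≤ 0 by linarith, h4]
  exact Nat.not_even_iff_odd.2 hodd (hs.even_cycleLength hZ)

/-! ### Counting cycles by the dimension of the cycle space -/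

variable [Fintype E(D)]

/-- If every cycle meets a given set of edges, then the cyclomatic number is at most the size of
that set. -/
theorem cyclomaticNumber_le_card [Finite V(D)] {T : Finset β}
    (hT : ∀ Z ∈ D.cycles, ∃ e ∈ T, e ∈ E(Z)) :
    D.cyclomaticNumber ≤ T.card := by
  classical
  let T' : Finset E(D) := Finset.univ.filter fun e => (e : β) ∈ T
  have hcard : T'.card ≤ T.card :=
    Finset.card_le_card_of_injOn Subtype.val (by intro e he; simpa [T'] using he)
      Subtype.val_injective.injOn
  let r : (E(D) → ZMod 2) →ₗ[ZMod 2] (T' → ZMod 2) := LinearMap.funLeft _ _ Subtype.val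
  have hinj : Function.Injective (r.domRestrict D.boundary.mulVecLin.ker) := by
    rw [← LinearMap.ker_eq_bot, LinearMap.ker_eq_bot']
    rintro ⟨z, hz⟩ hrz
    by_contra hne
    obtain ⟨Z, hZ, hZz⟩ := exists_cycle_of_mulVec_boundary_eq_zero (z := z) hz
      (fun h => hne (Subtype.ext h))
    obtain ⟨e, heT, heZ⟩ := hT Z hZ
    refine hZz ⟨e, hZ.1.edgeSet_mono heZ⟩ heZ ?_
    exact congrFun hrz ⟨⟨e, hZ.1.edgeSet_mono heZ⟩, by simpa [T'] using heT⟩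
  have := LinearMap.finrank_le_finrank_of_injective hinj
  rw [Module.finrank_pi, Fintype.card_coe] at this
  exact this.trans hcard

/-- The indicator of a cycle as an element of the cycle space. -/
noncomputable def cycleVector (Z : D.cycles) : D.boundary.mulVecLin.ker :=
  ⟨D.edgeIndicator Z, mulVec_boundary_edgeIndicator Z.2⟩

theorem cycleVector_ne_zero (Z : D.cycles) : cycleVector Z ≠ 0 := fun h =>
  edgeIndicator_ne_zero Z.2 (congrArg Subtype.val h)

theorem cycleVector_injective : Function.Injective (cycleVector (D := D)) := fun Z Z' h =>
  Subtype.ext (edgeIndicator_injOn Z.2 Z'.2 (congrArg Subtype.val h))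

theorem cycles_eq_empty_of_cyclomaticNumber_eq_zero (h : D.cyclomaticNumber = 0) :
    D.cycles = ∅ := by
  rw [cyclomaticNumber, Submodule.finrank_eq_zero] at h
  refine Set.eq_empty_of_forall_notMem fun Z hZ => edgeIndicator_ne_zero hZ ?_
  exact (Submodule.eq_bot_iff _).1 h _ (mulVec_boundary_edgeIndicator hZ)

theorem cyclomaticNumber_eq_zero_of_cycles_eq_empty [Finite V(D)] (h : D.cycles = ∅) :
    D.cyclomaticNumber = 0 := by
  simpa using cyclomaticNumber_le_card (D := D) (T := ∅) (by simp [h])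

theorem cyclomaticNumber_le_one [Finite V(D)] {Z : Graph α β}
    (h : D.cycles = {Z}) : D.cyclomaticNumber ≤ 1 := by
  have hZ : Z ∈ D.cycles := by simp [h]
  obtain ⟨e, he⟩ := IsCycleGraph.edgeSet_nonempty hZ.2
  simpa using cyclomaticNumber_le_card (D := D) (T := {e}) (by simpa [h] using he)

theorem cyclomaticNumber_le_two [Finite V(D)] {e f : β} (h : ∀ Z ∈ D.cycles, e ∈ E(Z) ∨ f ∈ E(Z)) :
    D.cyclomaticNumber ≤ 2 := by
  classical
  exact (cyclomaticNumber_le_card (D := D) (T := {e, f}) (by simpa using h)).trans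
    Finset.card_le_two

theorem exists_cycles_eq_singleton [Finite V(D)] (h : D.cyclomaticNumber = 1) : ∃ Z, D.cycles =
    {Z} := by
  have hne : D.cycles.Nonempty := by
    by_contra h0
    rw [Set.not_nonempty_iff_eq_empty] at h0
    have := cyclomaticNumber_eq_zero_of_cycles_eq_empty h0
    omega
  obtain ⟨Z, hZ⟩ := hne
  refine ⟨Z, Set.eq_singleton_iff_unique_mem.2 ⟨hZ, fun Z' hZ' => ?_⟩⟩
  obtain ⟨c, hc⟩ := (finrank_eq_one_iff_of_nonzero' _ (cycleVector_ne_zero ⟨Z, hZ⟩)).1 h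
    (cycleVector ⟨Z', hZ'⟩)
  have h01 : ∀ a : ZMod 2, a = 0 ∨ a = 1 := by decide
  rcases h01 c with rfl | rfl
  · exact absurd (by simpa using hc.symm) (cycleVector_ne_zero ⟨Z', hZ'⟩)
  · rw [one_smul] at hc
    exact congrArg Subtype.val (cycleVector_injective hc).symm

theorem edgeIndicator_add_eq (h : D.cyclomaticNumber = 2) {X Y W : Graph α β}
    (hX : X ∈ D.cycles) (hY : Y ∈ D.cycles) (hW : W ∈ D.cycles) (hXY : X ≠ Y) (hXW : X ≠ W)
    (hYW : Y ≠ W) : D.edgeIndicator X + D.edgeIndicator Y = D.edgeIndicator W := by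
  have hne {P Q : D.cycles} (hPQ : (P : Graph α β) ≠ Q) : cycleVector P ≠ cycleVector Q :=
    fun h' => hPQ (congrArg Subtype.val (cycleVector_injective h'))
  exact congrArg Subtype.val (add_eq_of_finrank_eq_two h (x := cycleVector ⟨X, hX⟩)
    (y := cycleVector ⟨Y, hY⟩) (z := cycleVector ⟨W, hW⟩) (cycleVector_ne_zero _)
    (cycleVector_ne_zero _) (cycleVector_ne_zero _) (hne hXY) (hne hXW) (hne hYW))

/-- Three cycles spanning a two-dimensional cycle space form a theta graph: any two of them share
an edge, because otherwise the third would properly contain them. -/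
theorem inter_edgeSet_nonempty {X Y W : Graph α β} (hX : X ∈ D.cycles)
    (hW : W ∈ D.cycles) (hXW : X ≠ W)
    (h : D.edgeIndicator X + D.edgeIndicator Y = D.edgeIndicator W) :
    (E(X) ∩ E(Y)).Nonempty := by
  by_contra hdisj
  rw [Set.not_nonempty_iff_eq_empty] at hdisj
  have hsupp (e : E(D)) (he : (e : β) ∉ E(W)) : D.edgeIndicator X e = 0 := by
    by_contra hXe
    rw [← ne_eq, edgeIndicator_ne_zero_iff] at hXe
    have hYe : (e : β) ∉ E(Y) := fun hYe => (hdisj ▸ ⟨hXe, hYe⟩ : (e : β) ∈ (∅ : Set β))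
    rw [← edgeIndicator_ne_zero_iff (D := D), ← h] at he
    simp [edgeIndicator, hXe, hYe] at he
  rcases eq_zero_or_eq_edgeIndicator hW (mulVec_boundary_edgeIndicator hX) hsupp with h1 | h1
  · exact edgeIndicator_ne_zero hX h1
  · exact hXW (edgeIndicator_injOn hX hW h1)

theorem cycleLength_add_even {X Y W : Graph α β} (hX : X ∈ D.cycles) (hY : Y ∈ D.cycles)
    (hW : W ∈ D.cycles) (h : D.edgeIndicator X + D.edgeIndicator Y = D.edgeIndicator W) :
    Even (X.cycleLength + Y.cycleLength + W.cycleLength) := by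
  rw [← ZMod.natCast_eq_zero_iff_even]
  push_cast
  rw [← sum_edgeIndicator hX, ← sum_edgeIndicator hY, ← sum_edgeIndicator hW, ← h,
    ← Finset.sum_add_distrib]
  exact CharTwo.add_self_eq_zero _

/-- The cycle space has just three nonzero vectors, so there are two or three cycles. If there are
three, their lengths have an even sum, so exactly two of them are odd. -/
theorem hasEdgeCycleContent_of_cyclomaticNumber_eq_two [Finite V(D)] (h : D.cyclomaticNumber = 2)
    {Z₁ : Graph α β}
    (hZ₁ : Z₁ ∈ D.cycles) (hodd : Odd Z₁.cycleLength) : D.HasEdgeCycleContent := by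
  obtain ⟨Z₂, hZ₂, h12⟩ : ∃ Z₂ ∈ D.cycles, Z₂ ≠ Z₁ := by
    by_contra! hcon
    have := cyclomaticNumber_le_one (Set.eq_singleton_iff_unique_mem.2 ⟨hZ₁, hcon⟩)
    omega
  by_cases h3 : ∃ Z₃ ∈ D.cycles, Z₃ ≠ Z₁ ∧ Z₃ ≠ Z₂
  · obtain ⟨Z₃, hZ₃, h13, h23⟩ := h3
    have hall : ∀ W ∈ D.cycles, W = Z₁ ∨ W = Z₂ ∨ W = Z₃ := by
      intro W hW
      by_contra! hcon
      have h4 := edgeIndicator_add_eq h hZ₁ hZ₂ hZ₃ h12.symm h13.symm h23.symm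
      have h5 := edgeIndicator_add_eq h hZ₁ hZ₂ hW h12.symm hcon.1.symm hcon.2.1.symm
      exact hcon.2.2 (edgeIndicator_injOn hW hZ₃ (h5.symm.trans h4))
    have e123 := edgeIndicator_add_eq h hZ₁ hZ₂ hZ₃ h12.symm h13.symm h23.symm
    have e132 := edgeIndicator_add_eq h hZ₁ hZ₃ hZ₂ h13.symm h12.symm h23
    have e231 := edgeIndicator_add_eq h hZ₂ hZ₃ hZ₁ h23.symm h12 h13
    have i12 := inter_edgeSet_nonempty hZ₁ hZ₃ h13.symm e123
    have i13 := inter_edgeSet_nonempty hZ₁ hZ₂ h12.symm e132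
    have i23 := inter_edgeSet_nonempty hZ₂ hZ₁ h12 e231
    have hev := cycleLength_add_even hZ₁ hZ₂ hZ₃ e123
    right; right
    rcases Nat.even_or_odd Z₂.cycleLength with h2 | h2
    · refine ⟨Z₂, Z₁, Z₃, h13.symm, ?_, h2, hodd, by grind, ?_, i23, i13⟩
      · ext W
        refine ⟨fun hW => ?_, ?_⟩
        · rcases hall W hW with rfl | rfl | rfl <;> simp
        · rintro (rfl | rfl | rfl) <;> assumption
      · rwa [Set.inter_comm]
    · refine ⟨Z₃, Z₁, Z₂, h12.symm, ?_, by grind, hodd, h2, ?_, ?_, i12⟩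
      · ext W
        refine ⟨fun hW => ?_, ?_⟩
        · rcases hall W hW with rfl | rfl | rfl <;> simp
        · rintro (rfl | rfl | rfl) <;> assumption
      · rwa [Set.inter_comm]
      · rwa [Set.inter_comm]
  · push Not at h3
    refine .inr (.inl ⟨Z₁, Z₂, h12.symm, Set.ext fun W => ⟨fun hW => ?_, ?_⟩, .inl hodd⟩)
    · by_cases hW1 : W = Z₁
      · simp [hW1]
      · simp [h3 W hW hW1]
    · rintro (rfl | rfl) <;> assumption

/-! ### Nullity and cycle content of a connected graph -/

theorem IsConnected.nullity_eq_or [Finite V(D)] (hD : D.IsConnected) :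
    ((∀ Z ∈ D.cycles, Even Z.cycleLength) ∧ D.nullity = D.cyclomaticNumber) ∨
    ∃ Z ∈ D.cycles, Odd Z.cycleLength ∧ D.nullity + 1 = D.cyclomaticNumber := by
  by_cases h : ∀ Z ∈ D.cycles, Even Z.cycleLength
  · obtain ⟨s, hs⟩ := exists_isTwoColoring_of_forall_even h
    exact .inl ⟨h, hD.nullity_eq_of_isTwoColoring hs⟩
  · push Not at h
    obtain ⟨Z, hZ, hodd⟩ := h
    rw [Nat.not_even_iff_odd] at hodd
    exact .inr ⟨Z, hZ, hodd, hD.nullity_add_one_of_odd hZ hodd⟩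

theorem IsConnected.nullity_eq_zero_iff [Finite V(D)] (hD : D.IsConnected) :
    D.nullity = 0 ↔ D.IsAcyclicOrOddUnicyclic := by
  constructor
  · intro h
    rcases hD.nullity_eq_or with ⟨-, h1⟩ | ⟨Z, hZ, hodd, h1⟩
    · exact .inl (cycles_eq_empty_of_cyclomaticNumber_eq_zero (by omega))
    · obtain ⟨Z', hZ'⟩ := exists_cycles_eq_singleton (D := D) (by omega)
      rw [hZ'] at hZ
      exact .inr ⟨Z', hZ', hZ ▸ hodd⟩
  · rintro (h | ⟨Z, hZ, hodd⟩)
    · have := cyclomaticNumber_eq_zero_of_cycles_eq_empty h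
      rcases hD.nullity_eq_or with ⟨-, h1⟩ | ⟨Z, hZ, hodd, h1⟩ <;> omega
    · have := cyclomaticNumber_le_one hZ
      have := hD.nullity_add_one_of_odd (Z := Z) (by simp [hZ]) hodd
      omega

theorem IsConnected.hasEdgeCycleContent_of_nullity_eq_one [Finite V(D)] (hD : D.IsConnected)
    (h : D.nullity = 1) : D.HasEdgeCycleContent := by
  rcases hD.nullity_eq_or with ⟨heven, h1⟩ | ⟨Z, hZ, hodd, h1⟩
  · obtain ⟨Z, hZ⟩ := exists_cycles_eq_singleton (D := D) (by omega)
    exact .inl ⟨Z, hZ, heven Z (by simp [hZ])⟩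
  · exact hasEdgeCycleContent_of_cyclomaticNumber_eq_two (by omega) hZ hodd

theorem IsConnected.nullity_le_one_of_hasEdgeCycleContent [Finite V(D)] (hD : D.IsConnected)
    (h : D.HasEdgeCycleContent) : D.nullity ≤ 1 := by
  rcases h with ⟨Z, hZ, -⟩ | ⟨Z₁, Z₂, -, hZ, hodd⟩ |
    ⟨Z₀, Z₁, Z₂, -, hZ, -, hodd, -, ⟨e, he0, he1⟩, -⟩
  · have := cyclomaticNumber_le_one hZ
    rcases hD.nullity_eq_or with ⟨-, h1⟩ | ⟨Z, hZ, hodd, h1⟩ <;> omega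
  · have hZ₁ : Z₁ ∈ D.cycles := by simp [hZ]
    have hZ₂ : Z₂ ∈ D.cycles := by simp [hZ]
    obtain ⟨e, he⟩ := IsCycleGraph.edgeSet_nonempty hZ₁.2
    obtain ⟨f, hf⟩ := IsCycleGraph.edgeSet_nonempty hZ₂.2
    have := cyclomaticNumber_le_two (D := D) (e := e) (f := f) (by
      rw [hZ]
      rintro Z (rfl | rfl)
      · exact .inl he
      · exact .inr hf)
    rcases hodd with hodd | hodd
    · have := hD.nullity_add_one_of_odd hZ₁ hodd
      omega
    · have := hD.nullity_add_one_of_odd hZ₂ hodd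
      omega
  · have hZ₁ : Z₁ ∈ D.cycles := by simp [hZ]
    have hZ₂ : Z₂ ∈ D.cycles := by simp [hZ]
    -- An edge common to two of the cycles, together with an edge of the third, meets all three.
    obtain ⟨f, hf⟩ := IsCycleGraph.edgeSet_nonempty hZ₂.2
    have := cyclomaticNumber_le_two (D := D) (e := e) (f := f) (by
      rw [hZ]
      rintro Z (rfl | rfl | rfl)
      · exact .inl he0
      · exact .inl he1
      · exact .inr hf)
    have := hD.nullity_add_one_of_odd hZ₁ hodd
    omega

end Graph

namespace Graph

variable {α β : Type*} {G H C D : Graph α β}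

/-! ### Components -/

/-- The subgraph of `H` induced by the vertices that can be reached from `x`. -/
def reachable (H : Graph α β) (x : α) : Graph α β :=
  H.induce {y | Relation.ReflTransGen H.Adj x y}

theorem mem_vertexSet_of_reflTransGen {x y : α} (hx : x ∈ V(H))
    (h : Relation.ReflTransGen H.Adj x y) : y ∈ V(H) := by
  induction h with
  | refl => exact hx
  | tail _ h _ => exact h.right_mem

theorem reachable_le {x : α} (hx : x ∈ V(H)) : H.reachable x ≤ H :=
  induce_le fun _ hy => mem_vertexSet_of_reflTransGen hx hy

theorem reachable_isConnected (H : Graph α β) (x : α) : (H.reachable x).IsConnected := by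
  have key (y : α) (hy : Relation.ReflTransGen H.Adj x y) :
      Relation.ReflTransGen (H.reachable x).Adj x y := by
    induction hy with
    | refl => exact .refl
    | tail hb hbc ih =>
      obtain ⟨e, he⟩ := hbc
      exact ih.tail ⟨e, he, hb, hb.tail ⟨e, he⟩⟩
  refine ⟨⟨x, .refl⟩, fun y hy z hz => ?_⟩
  exact (Std.Symm.symm _ _ (key y hy)).trans (key z hz)

theorem IsConnected.le_reachable (hD : D.IsConnected) (hDH : D ≤ H) {x : α} (hx : x ∈ V(D)) :
    D ≤ H.reachable x := by
  have hV (y : α) (hy : y ∈ V(D)) : Relation.ReflTransGen H.Adj x y :=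
    Relation.ReflTransGen.mono (fun _ _ (h : D.Adj _ _) => h.mono hDH) _ _ (hD.2 x hx y hy)
  exact ⟨hV, fun e y z h => ⟨h.mono hDH, hV y h.left_mem, hV z h.right_mem⟩⟩

theorem reachable_isComponent {x : α} (hx : x ∈ V(H)) : H.IsComponent (H.reachable x) :=
  ⟨⟨reachable_le hx, reachable_isConnected H x⟩, fun _ hD h =>
    hD.2.le_reachable hD.1 (h.vertexSet_mono (Relation.ReflTransGen.refl (a := x)))⟩

/-- A component is the part of the graph that can be reached from any one of its vertices. -/
theorem IsComponent.eq_reachable (hC : H.IsComponent C) {x : α} (hx : x ∈ V(C)) :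
    C = H.reachable x := by
  have hle := hC.1.2.le_reachable hC.1.1 hx
  exact le_antisymm hle
    (hC.2 ⟨reachable_le (hC.1.1.vertexSet_mono hx), reachable_isConnected H x⟩ hle)

theorem IsComponent.edge_mem_of_inc (hC : H.IsComponent C) {x : α} (hx : x ∈ V(C)) {e : β}
    (he : H.Inc e x) : e ∈ E(C) := by
  obtain ⟨y, h⟩ := he
  rw [hC.eq_reachable hx]
  exact IsLink.edge_mem (x := x) (y := y) ⟨h, .refl, .single ⟨e, h⟩⟩

theorem IsComponent.eq_of_edge_mem (hC : H.IsComponent C) (hD : H.IsComponent D) {e : β}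
    (heC : e ∈ E(C)) (heD : e ∈ E(D)) : C = D := by
  obtain ⟨x, y, h⟩ := exists_isLink_of_mem_edgeSet heC
  have hxD : x ∈ V(D) :=
    ((IsSubgraph.inc_congr hD.1.1 heD).2 (h.mono hC.1.1).inc_left).vertex_mem
  rw [hC.eq_reachable h.left_mem, hD.eq_reachable hxD]

theorem exists_isComponent_of_edge_mem {e : β} (he : e ∈ E(H)) :
    ∃ C, H.IsComponent C ∧ e ∈ E(C) := by
  obtain ⟨x, y, h⟩ := exists_isLink_of_mem_edgeSet he
  exact ⟨_, reachable_isComponent h.left_mem, (reachable_isComponent h.left_mem).edge_mem_of_inc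
    (Relation.ReflTransGen.refl (a := x)) h.inc_left⟩

/-! ### Restricting kernel vectors to components -/

open Classical in
/-- The vector obtained from `d` by setting to zero the entries of the edges outside `D`. -/
noncomputable def mask (D : Graph α β) (d : E(G) → ℝ) : E(G) → ℝ :=
  fun e => if (e : β) ∈ E(D) then d e else 0

theorem mask_apply_of_mem {d : E(G) → ℝ} {e : E(G)} (he : (e : β) ∈ E(D)) :
    mask D d e = d e := if_pos he

theorem mask_apply_of_notMem {d : E(G) → ℝ} {e : E(G)} (he : (e : β) ∉ E(D)) :
    mask D d e = 0 := if_neg he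

theorem incidence_of_not_inc {v : V(G)} {e : E(G)} (h : ¬ G.Inc e v) : G.incidence v e = 0 :=
  if_neg h

theorem mulVec_incidence_apply [Fintype E(G)] (d : E(G) → ℝ) (v : V(G)) :
    G.incidence.mulVec d v = ∑ e, G.incidence v e * d e := rfl

theorem mulVec_incidence_of_le [Fintype E(G)] [Fintype E(D)] (hDG : D ≤ G) {d : E(G) → ℝ}
    (hd : ∀ e : E(G), (e : β) ∉ E(D) → d e = 0) (v : V(D)) :
    D.incidence.mulVec (fun e => d ⟨e, hDG.edgeSet_mono e.2⟩) v =
      G.incidence.mulVec d ⟨v, hDG.vertexSet_mono v.2⟩ := by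
  classical
  rw [mulVec_incidence_apply, mulVec_incidence_apply]
  refine Fintype.sum_of_injective (fun e : E(D) => (⟨e, hDG.edgeSet_mono e.2⟩ : E(G)))
    (Set.inclusion_injective hDG.edgeSet_mono) _ _ (fun e he => ?_) fun e => ?_
  · rw [hd e fun h => he ⟨⟨e, h⟩, rfl⟩, mul_zero]
  · exact congrArg (· * _) (if_congr (IsSubgraph.inc_congr hDG e.2) rfl rfl)

/-- A kernel vector on `D`, extended by zero, is a kernel vector on `G`, and conversely. -/
theorem mulVec_incidence_eq_zero_iff_of_le [Fintype E(G)] [Fintype E(D)] (hDG : D ≤ G)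
    {d : E(G) → ℝ}
    (hd : ∀ e : E(G), (e : β) ∉ E(D) → d e = 0) :
    D.incidence.mulVec (fun e => d ⟨e, hDG.edgeSet_mono e.2⟩) = 0 ↔
      G.incidence.mulVec d = 0 := by
  constructor
  · intro h
    ext v
    by_cases hv : (v : α) ∈ V(D)
    · rw [← mulVec_incidence_of_le hDG hd ⟨v, hv⟩, h]
      rfl
    · rw [mulVec_incidence_apply]
      refine Finset.sum_eq_zero fun e _ => ?_
      by_cases he : (e : β) ∈ E(D)
      · rw [incidence_of_not_inc, zero_mul]
        exact fun h' => hv ((IsSubgraph.inc_congr hDG he).2 h').vertex_mem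
      · rw [hd e he, mul_zero]
  · intro h
    ext v
    rw [mulVec_incidence_of_le hDG hd, h]
    rfl

/-- Restricting a kernel vector supported on `H` to a component of `H` gives a kernel vector,
because all edges of `H` at a vertex of the component belong to it. -/
theorem IsComponent.mulVec_incidence_mask [Fintype E(G)] (hC : H.IsComponent C) (hHG : H ≤ G)
    {d : E(G) → ℝ}
    (hd : ∀ e : E(G), (e : β) ∉ E(H) → d e = 0) (hker : G.incidence.mulVec d = 0) :
    G.incidence.mulVec (mask C d) = 0 := by
  ext v
  by_cases hv : (v : α) ∈ V(C)
  · rw [← hker, mulVec_incidence_apply, mulVec_incidence_apply]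
    refine Finset.sum_congr rfl fun e _ => ?_
    by_cases he : (e : β) ∈ E(C)
    · rw [mask_apply_of_mem he]
    · rw [mask_apply_of_notMem he]
      by_cases heH : (e : β) ∈ E(H)
      · rw [incidence_of_not_inc, zero_mul, zero_mul]
        exact fun h => he (hC.edge_mem_of_inc hv ((IsSubgraph.inc_congr hHG heH).2 h))
      · rw [hd e heH]
  · rw [mulVec_incidence_apply]
    refine Finset.sum_eq_zero fun e _ => ?_
    by_cases he : (e : β) ∈ E(C)
    · rw [incidence_of_not_inc, zero_mul]
      exact fun h => hv ((IsSubgraph.inc_congr (hC.1.1.trans hHG) he).2 h).vertex_mem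
    · rw [mask_apply_of_notMem he, mul_zero]

theorem nullity_eq_zero_iff_of_le [Fintype E(G)] [Fintype E(D)] (hDG : D ≤ G) :
    D.nullity = 0 ↔
      ∀ d : E(G) → ℝ, (∀ e : E(G), (e : β) ∉ E(D) → d e = 0) →
        G.incidence.mulVec d = 0 → d = 0 := by
  classical
  rw [nullity, Submodule.finrank_eq_zero, LinearMap.ker_eq_bot']
  constructor
  · intro h d hd hker
    have h1 := h _ ((mulVec_incidence_eq_zero_iff_of_le hDG hd).2 hker)
    ext e
    by_cases he : (e : β) ∈ E(D)
    · exact congrFun h1 ⟨e, he⟩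
    · exact hd e he
  · intro h z hz
    let d : E(G) → ℝ := fun e => if he : (e : β) ∈ E(D) then z ⟨e, he⟩ else 0
    have hd : ∀ e : E(G), (e : β) ∉ E(D) → d e = 0 := fun e he => dif_neg he
    have hdz : (fun e : E(D) => d ⟨e, hDG.edgeSet_mono e.2⟩) = z := by ext e; simp [d]
    have h1 := h d hd ((mulVec_incidence_eq_zero_iff_of_le hDG hd).1 (by rwa [hdz]))
    rw [← hdz, h1]
    rfl

/-- In the presence of a nonzero kernel vector `a`, nullity at most one means that every
kernel vector is a multiple of `a`. -/
theorem nullity_le_one_iff_of_le [Fintype E(G)] [Fintype E(D)] (hDG : D ≤ G) {a : E(G) → ℝ}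
    (ha0 : a ≠ 0)
    (ha : ∀ e : E(G), (e : β) ∉ E(D) → a e = 0) (hker : G.incidence.mulVec a = 0) :
    D.nullity ≤ 1 ↔ ∀ d : E(G) → ℝ, (∀ e : E(G), (e : β) ∉ E(D) → d e = 0) →
      G.incidence.mulVec d = 0 → ∃ c : ℝ, d = c • a := by
  classical
  have hne : D.nullity ≠ 0 := fun h => ha0 ((nullity_eq_zero_iff_of_le hDG).1 h a ha hker)
  let a' : LinearMap.ker D.incidence.mulVecLin :=
    ⟨fun e => a ⟨e, hDG.edgeSet_mono e.2⟩, (mulVec_incidence_eq_zero_iff_of_le hDG ha).2 hker⟩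
  have ha' : a' ≠ 0 := by
    refine fun h => ha0 (funext fun e => ?_)
    by_cases he : (e : β) ∈ E(D)
    · exact congrFun (congrArg Subtype.val h) ⟨e, he⟩
    · exact ha e he
  rw [show D.nullity ≤ 1 ↔ D.nullity = 1 by omega, nullity,
    finrank_eq_one_iff_of_nonzero' a' ha']
  constructor
  · intro h d hd hdker
    obtain ⟨c, hc⟩ := h ⟨_, (mulVec_incidence_eq_zero_iff_of_le hDG hd).2 hdker⟩
    refine ⟨c, funext fun e => ?_⟩
    by_cases he : (e : β) ∈ E(D)
    · exact (congrFun (congrArg Subtype.val hc) ⟨e, he⟩).symm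
    · simp [hd e he, ha e he]
  · rintro h ⟨z, hz⟩
    let d : E(G) → ℝ := fun e => if he : (e : β) ∈ E(D) then z ⟨e, he⟩ else 0
    have hd : ∀ e : E(G), (e : β) ∉ E(D) → d e = 0 := fun e he => dif_neg he
    have hdz : (fun e : E(D) => d ⟨e, hDG.edgeSet_mono e.2⟩) = z := by ext e; simp [d]
    obtain ⟨c, hc⟩ := h d hd ((mulVec_incidence_eq_zero_iff_of_le hDG hd).1 (by
      rw [hdz]; exact hz))
    refine ⟨c, Subtype.ext (Eq.trans ?_ hdz)⟩
    rw [hc]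
    rfl

/-- Since kernel vectors split along components, a kernel vector `a ≠ 0` of a subgraph `H` spans its
kernel if and only if one component of `H` has nullity one and all others have nullity zero. Here
this is expressed by cycle contents. -/
theorem forall_exists_eq_smul_iff [Fintype E(G)] [Finite V(G)] (hHG : H ≤ G) {a : E(G) → ℝ}
    (ha0 : a ≠ 0)
    (ha : ∀ e : E(G), (e : β) ∉ E(H) → a e = 0) (hker : G.incidence.mulVec a = 0) :
    (∀ d : E(G) → ℝ, G.incidence.mulVec d = 0 → (∀ e : E(G), (e : β) ∉ E(H) → d e = 0) →
      ∃ c : ℝ, d = c • a) ↔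
    ∃ C, H.IsComponent C ∧ (∀ D, H.IsComponent D → D ≠ C → D.IsAcyclicOrOddUnicyclic) ∧
      C.HasEdgeCycleContent := by
  have hfinE {D : Graph α β} (hD : H.IsComponent D) : Finite E(D) :=
    Finite.Set.subset E(G) (hD.1.1.trans hHG).edgeSet_mono
  have hfinV {D : Graph α β} (hD : H.IsComponent D) : Finite V(D) :=
    Finite.Set.subset V(G) (hD.1.1.trans hHG).vertexSet_mono
  have hout {D : Graph α β} (hD : H.IsComponent D) {d : E(G) → ℝ}
      (hd : ∀ e : E(G), (e : β) ∉ E(D) → d e = 0) (e : E(G)) (he : (e : β) ∉ E(H)) : d e = 0 :=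
    hd e fun h => he (hD.1.1.edgeSet_mono h)
  constructor
  · intro h
    obtain ⟨e₀, he₀⟩ := Function.ne_iff.1 ha0
    have he₀H : (e₀ : β) ∈ E(H) := by_contra fun h' => he₀ (ha e₀ h')
    obtain ⟨C, hC, he₀C⟩ := exists_isComponent_of_edge_mem he₀H
    -- The restriction of `a` to `C` is a nonzero multiple of `a`, so `a` lives on `C`.
    have haC (e : E(G)) (he : (e : β) ∉ E(C)) : a e = 0 := by
      have hmask (e : E(G)) (he : (e : β) ∉ E(C)) : mask C a e = 0 := mask_apply_of_notMem he
      obtain ⟨c, hc⟩ := h _ (hC.mulVec_incidence_mask hHG ha hker) (hout hC hmask)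
      have h1 : c ≠ 0 := by
        rintro rfl
        have := congrFun hc e₀
        rw [mask_apply_of_mem he₀C] at this
        exact he₀ (by simpa using this)
      have h2 := congrFun hc e
      rw [hmask e he] at h2
      simpa [h1] using h2
    refine ⟨C, hC, fun D hD hDC => ?_, ?_⟩
    · have := hfinV hD
      have := hfinE hD
      have := Fintype.ofFinite E(D)
      rw [← hD.1.2.nullity_eq_zero_iff, nullity_eq_zero_iff_of_le (hD.1.1.trans hHG)]
      intro d hd hdker
      obtain ⟨c, rfl⟩ := h d hdker (hout hD hd)
      ext e
      by_cases he : (e : β) ∈ E(D)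
      · simp [haC e fun he' => hDC (hD.eq_of_edge_mem hC he he')]
      · exact hd e he
    · have := hfinV hC
      have := hfinE hC
      have := Fintype.ofFinite E(C)
      have hCG := hC.1.1.trans hHG
      have h1 : C.nullity ≤ 1 := (nullity_le_one_iff_of_le hCG ha0 haC hker).2
        fun d hd hdker => h d hdker (hout hC hd)
      have h0 : C.nullity ≠ 0 := fun h0 =>
        ha0 ((nullity_eq_zero_iff_of_le hCG).1 h0 a haC hker)
      exact hC.1.2.hasEdgeCycleContent_of_nullity_eq_one (by omega)
  · rintro ⟨C, hC, hother, hcontent⟩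
    have := hfinV hC
    have := hfinE hC
    have := Fintype.ofFinite E(C)
    have hCG := hC.1.1.trans hHG
    have hsupp (d : E(G) → ℝ) (hdker : G.incidence.mulVec d = 0)
        (hd : ∀ e : E(G), (e : β) ∉ E(H) → d e = 0) (e : E(G)) (he : (e : β) ∉ E(C)) : d e = 0 := by
      by_cases heH : (e : β) ∈ E(H)
      · obtain ⟨D, hD, heD⟩ := exists_isComponent_of_edge_mem heH
        have := hfinV hD
        have := hfinE hD
        have := Fintype.ofFinite E(D)
        have h0 := hD.1.2.nullity_eq_zero_iff.2 (hother D hD (by rintro rfl; exact he heD))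
        have h1 := (nullity_eq_zero_iff_of_le (hD.1.1.trans hHG)).1 h0 (mask D d)
          (fun e he => mask_apply_of_notMem he) (hD.mulVec_incidence_mask hHG hd hdker)
        rw [← mask_apply_of_mem (d := d) heD, h1]
        rfl
      · exact hd e heH
    intro d hdker hd
    exact (nullity_le_one_iff_of_le hCG ha0 (hsupp a hker ha) hker).1
      (hC.1.2.nullity_le_one_of_hasEdgeCycleContent hcontent) d (hsupp d hdker hd) hdker

theorem mem_fracPerfectMatchingPolytope_iff [Fintype E(G)] (b : V(G) → ℝ≥0) (x : E(G) → ℝ) :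
    x ∈ G.fracPerfectMatchingPolytope b ↔
      (∀ e, 0 ≤ x e) ∧ G.incidence.mulVecLin x = fun v => (b v : ℝ) := by
  simp only [fracPerfectMatchingPolytope, Set.mem_ofPred_eq, funext_iff, Matrix.mulVecLin_apply,
    Matrix.mulVec, dotProduct, incidence, ite_mul, one_mul, zero_mul, Finset.sum_filter]

theorem mem_edgeSet_spanningUnion_gr_iff (u w : E(G) → ℝ) (e : E(G)) :
    (e : β) ∈ E(G.spanningUnion (G.gr u) (G.gr w)) ↔ u e ≠ 0 ∨ w e ≠ 0 := by
  simp [spanningUnion, gr]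

end Graph

theorem theorem7p9 {α β : Type*} (G : Graph α β) [Finite V(G)] [Fintype E(G)]
    (b : V(G) → ℝ≥0) (u w : E(G) → ℝ)
    (hu : u ∈ (G.fracPerfectMatchingPolytope b).exposedPoints ℝ)
    (hw : w ∈ (G.fracPerfectMatchingPolytope b).exposedPoints ℝ)
    (huw : u ≠ w) :
    AreVerticesOfEdge (G.fracPerfectMatchingPolytope b) u w ↔
      ∃ C : Graph α β,
        (G.spanningUnion (G.gr u) (G.gr w)).IsComponent C ∧
        (∀ D : Graph α β, (G.spanningUnion (G.gr u) (G.gr w)).IsComponent D → D ≠ C →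
          D.IsAcyclicOrOddUnicyclic) ∧
        C.HasEdgeCycleContent := by
  have hP := G.mem_fracPerfectMatchingPolytope_iff b
  have hsupp (d : E(G) → ℝ) : (∀ e, u e = 0 → w e = 0 → d e = 0) ↔
      ∀ e : E(G), (e : β) ∉ E(G.spanningUnion (G.gr u) (G.gr w)) → d e = 0 := by
    simp only [Graph.mem_edgeSet_spanningUnion_gr_iff, not_or, not_not, and_imp]
  rw [areVerticesOfEdge_iff G.incidence.mulVecLin _ hP hu hw huw,
    ← Graph.forall_exists_eq_smul_iff (G := G) (H := G.spanningUnion (G.gr u) (G.gr w))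
      Graph.restrict_le (sub_ne_zero.2 huw)]
  · simp only [hsupp, Matrix.mulVecLin_apply]
  · rw [← hsupp]
    intro e h1 h2
    simp [h1, h2]
  · rw [← Matrix.mulVecLin_apply, map_sub, ((hP u).1 hu.1).2, ((hP w).1 hw.1).2, sub_self]
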